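/- Let $c\ge 0$ and let $\mathbb{H}_c=L^2(\mathbb{R},e^{-2ct}\,dt)$ be the complex Hilbert space of (classes of) functions $f:\mathbb{R}\to\mathbb{C}$ that are square-integrable with respect to the measure $e^{-2ct}\,dt$. Let $\partial_c$ be the unbounded linear operator on $\mathbb{H}_c$ with domain $$D(\partial_c)=\{f\in\mathbb{H}_c : f \text{ is locally absolutely continuous on } \mathbb{R} \text{ and } f'\in\mathbb{H}_c\},\qquad \partial_c f=f',$$ and let $V_c=\frac{1}{i}(\partial_c-c)$ with $D(V_c)=D(\partial_c)$, so that $\partial_c=c+iV_c$. For an unbounded operator $T$, let $\sigma(T)$ be its spectrum (the set of $\lambda\in\mathbb{C}$ for which $T-\lambda$ is not a bijection of $D(T)$ onto the whole space with bounded inverse) and let $\sigma_e(T)$ be its essential spectrum (the set of $\lambda\in\mathbb{C}$ for which $T-\lambda$ is not Fredholm, i.e. does not have finite-dimensional kernel and closed range of finite codimension). Then $$\sigma(\partial_c)=\sigma_e(\partial_c)=\{\lambda\in\mathbb{C} : \operatorname{Re}(\lambda)=c\} \qquad\text{and}\qquad \sigma(V_c)=\sigma_e(V_c)=\mathbb{R}.$$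 -/

import Mathlib

open MeasureTheory

noncomputable section

namespace InfinitesimalShift

section Abstract

variable {H : Type*} [NormedAddCommGroup H] [NormedSpace ℂ H]

/-- The operator `T - z` (that is, `T` minus `z` times the identity) on the domain of `T`. -/
def subScalar (T : H →ₗ.[ℂ] H) (z : ℂ) : H →ₗ.[ℂ] H where
  domain := T.domain
  toFun := T.toFun - z • T.domain.subtype

/-- The resolvent set of an unbounded operator: all `z` such that `T - z` is a bijection from the
domain of `T` onto `H` whose inverse `R` is a bounded operator on `H`. -/
def resolventSet (T : H →ₗ.[ℂ] H) : Set ℂ :=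
  {z | ∃ R : H →L[ℂ] H,
    (∀ y : H, ∃ hy : R y ∈ T.domain, subScalar T z ⟨R y, hy⟩ = y) ∧
    (∀ x : T.domain, R (subScalar T z x) = x)}

/-- The spectrum of an unbounded operator. -/
def spectrum (T : H →ₗ.[ℂ] H) : Set ℂ := (resolventSet T)ᶜ

/-- Fredholm operators: finite-dimensional kernel, closed range, range of finite codimension. -/
structure IsFredholm (T : H →ₗ.[ℂ] H) : Prop where
  finite_ker : FiniteDimensional ℂ (LinearMap.ker T.toFun)
  isClosed_range : IsClosed (LinearMap.range T.toFun : Set H)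
  finite_coker : FiniteDimensional ℂ (H ⧸ LinearMap.range T.toFun)

/-- The essential spectrum: all `z` such that `T - z` is not Fredholm. -/
def essentialSpectrum (T : H →ₗ.[ℂ] H) : Set ℂ := {z | ¬ IsFredholm (subScalar T z)}

end Abstract

/-- The measure `e^{-2ct} dt` on the real line. -/
def weightedMeasure (c : ℝ) : Measure ℝ :=
  volume.withDensity fun t => ENNReal.ofReal (Real.exp (-2 * c * t))

/-- The Hilbert space `L²(ℝ, e^{-2ct} dt)` of complex-valued functions. -/
abbrev WeightedL2 (c : ℝ) : Type := Lp ℂ 2 (weightedMeasure c)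

/-- Locally absolutely continuous functions on the real line. -/
def LocallyAC (g : ℝ → ℂ) : Prop := ∀ a b : ℝ, AbsolutelyContinuousOnInterval g a b

/-- `g` is a locally absolutely continuous representative of `f`, and the (a.e. defined)
derivative of `g` is again in `L²(ℝ, e^{-2ct} dt)`. -/
structure IsRegularRep (c : ℝ) (f : WeightedL2 c) (g : ℝ → ℂ) : Prop where
  ae_eq : f =ᵐ[weightedMeasure c] g
  locallyAC : LocallyAC g
  memLp_deriv : MemLp (deriv g) 2 (weightedMeasure c)

theorem ae_weightedMeasure_iff (c : ℝ) {p : ℝ → Prop} :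
    (∀ᵐ t ∂(weightedMeasure c), p t) ↔ ∀ᵐ t, p t := by
  unfold weightedMeasure
  rw [ae_withDensity_iff (by fun_prop)]
  simp [Real.exp_pos]

theorem LocallyAC.continuous {g : ℝ → ℂ} (hg : LocallyAC g) : Continuous g := by
  rw [continuous_iff_continuousAt]
  intro x
  refine (hg (x - 1) (x + 1)).continuousOn.continuousAt ?_
  rw [Set.uIcc_of_le (by linarith)]
  exact Icc_mem_nhds (by linarith) (by linarith)

theorem LocallyAC.ae_differentiableAt {g : ℝ → ℂ} (hg : LocallyAC g) :
    ∀ᵐ t : ℝ, DifferentiableAt ℝ g t := by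
  have h : ∀ n : ℕ, ∀ᵐ t : ℝ, t ∈ Set.uIcc (-(n : ℝ)) n → DifferentiableAt ℝ g t := fun n =>
    (hg (-(n : ℝ)) n).boundedVariationOn.ae_differentiableAt_of_mem_uIcc
  filter_upwards [ae_all_iff.2 h] with t ht
  obtain ⟨n, hn⟩ := exists_nat_ge |t|
  refine ht n ?_
  rw [Set.uIcc_of_le (by linarith [abs_nonneg t])]
  exact abs_le.1 hn

theorem IsRegularRep.unique {c : ℝ} {f : WeightedL2 c} {g₁ g₂ : ℝ → ℂ}
    (h₁ : IsRegularRep c f g₁) (h₂ : IsRegularRep c f g₂) : g₁ = g₂ := by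
  have h : ∀ᵐ t ∂(weightedMeasure c), g₁ t = g₂ t := h₁.ae_eq.symm.trans h₂.ae_eq
  exact Continuous.ae_eq_iff_eq volume h₁.locallyAC.continuous h₂.locallyAC.continuous |>.1
    ((ae_weightedMeasure_iff c).1 h)

theorem IsRegularRep.deriv_add {c : ℝ} {f₁ f₂ : WeightedL2 c} {g₁ g₂ : ℝ → ℂ}
    (h₁ : IsRegularRep c f₁ g₁) (h₂ : IsRegularRep c f₂ g₂) :
    deriv (g₁ + g₂) =ᵐ[weightedMeasure c] deriv g₁ + deriv g₂ := by
  refine (ae_weightedMeasure_iff c).2 ?_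
  filter_upwards [h₁.locallyAC.ae_differentiableAt, h₂.locallyAC.ae_differentiableAt] with t a b
  exact _root_.deriv_add a b

theorem deriv_smul_fun (z : ℂ) (g : ℝ → ℂ) : deriv (z • g) = z • deriv g := by
  funext t
  exact deriv_const_mul_field z

theorem IsRegularRep.add {c : ℝ} {f₁ f₂ : WeightedL2 c} {g₁ g₂ : ℝ → ℂ}
    (h₁ : IsRegularRep c f₁ g₁) (h₂ : IsRegularRep c f₂ g₂) :
    IsRegularRep c (f₁ + f₂) (g₁ + g₂) where
  ae_eq := (Lp.coeFn_add f₁ f₂).trans (h₁.ae_eq.add h₂.ae_eq)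
  locallyAC := fun a b => (h₁.locallyAC a b).add (h₂.locallyAC a b)
  memLp_deriv := (h₁.memLp_deriv.add h₂.memLp_deriv).ae_eq (h₁.deriv_add h₂).symm

theorem IsRegularRep.smul {c : ℝ} {f : WeightedL2 c} {g : ℝ → ℂ} (z : ℂ)
    (h : IsRegularRep c f g) : IsRegularRep c (z • f) (z • g) where
  ae_eq := (Lp.coeFn_smul z f).trans (h.ae_eq.const_smul z)
  locallyAC := fun a b => (h.locallyAC a b).const_smul z
  memLp_deriv := by
    rw [deriv_smul_fun]
    exact h.memLp_deriv.const_smul z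

theorem IsRegularRep.zero (c : ℝ) : IsRegularRep c 0 0 where
  ae_eq := Lp.coeFn_zero ℂ 2 (weightedMeasure c)
  locallyAC := fun a b =>
    (contDiff_const (c := (0 : ℂ))).contDiffOn.absolutelyContinuousOnInterval
  memLp_deriv := by
    rw [deriv_zero]
    exact MemLp.zero

/-- The domain of the infinitesimal shift: all `f ∈ L²(ℝ, e^{-2ct} dt)` that are locally absolutely
continuous (have such a representative) with `f' ∈ L²(ℝ, e^{-2ct} dt)`. -/
def shiftDomain (c : ℝ) : Submodule ℂ (WeightedL2 c) where
  carrier := {f | ∃ g : ℝ → ℂ, IsRegularRep c f g}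
  add_mem' := fun ⟨_, h₁⟩ ⟨_, h₂⟩ => ⟨_, h₁.add h₂⟩
  zero_mem' := ⟨_, IsRegularRep.zero c⟩
  smul_mem' := fun z _ ⟨_, h⟩ => ⟨_, h.smul z⟩

/-- The (unique) locally absolutely continuous representative of an element of the domain. -/
def rep {c : ℝ} (f : shiftDomain c) : ℝ → ℂ := f.2.choose

theorem isRegularRep_rep {c : ℝ} (f : shiftDomain c) : IsRegularRep c f (rep f) :=
  f.2.choose_spec

/-- The infinitesimal shift `∂_c f = f'` on the weighted space `L²(ℝ, e^{-2ct} dt)`. -/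
def infShift (c : ℝ) : WeightedL2 c →ₗ.[ℂ] WeightedL2 c where
  domain := shiftDomain c
  toFun :=
    { toFun := fun f => (isRegularRep_rep f).memLp_deriv.toLp (deriv (rep f))
      map_add' := fun f₁ f₂ => by
        rw [← MemLp.toLp_add, MemLp.toLp_eq_toLp_iff,
          (isRegularRep_rep (f₁ + f₂)).unique ((isRegularRep_rep f₁).add (isRegularRep_rep f₂))]
        exact (isRegularRep_rep f₁).deriv_add (isRegularRep_rep f₂)
      map_smul' := fun z f => by
        rw [RingHom.id_apply, ← MemLp.toLp_const_smul, MemLp.toLp_eq_toLp_iff,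
          (isRegularRep_rep (z • f)).unique ((isRegularRep_rep f).smul z), deriv_smul_fun] }

/-- The operator `V_c = (∂_c - c) / i`, so that `∂_c = c + i V_c`, on the domain of `∂_c`. -/
def momentum (c : ℝ) : WeightedL2 c →ₗ.[ℂ] WeightedL2 c :=
  Complex.I⁻¹ • subScalar (infShift c) (c : ℂ)

end InfinitesimalShift

end

/-! The equation `(∂_c - z) u = f` is the ODE `u' = z u + f`, and multiplication by `e^{-ct}`
carries the weighted space to `L²(ℝ)` and replaces `z` by `w = z - c`.

If `Re w ≠ 0`, homogeneous solutions are multiples of an exponential that is bounded below on a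
half-line, so the kernel is trivial. Integrating from the infinite end at which `e^{-wt}` decays
gives a solution dominated by a convolution of `|F|`, `F = e^{-ct} f`, with an exponential kernel of
mass `1/|Re w|`; the Schur test bounds the inverse (`exists_solution`).

If `Re z = c`, multiply by `e^{-zt}` instead: `f` is in the range only if `e^{-zt} f` has an
antiderivative in `L²(ℝ)`. The derivative of `P(log(1+t²))` is square-integrable for every
polynomial `P`, yet no antiderivative of it is unless `P` is constant. This embeds an
infinite-dimensional space in the cokernel (`not_finiteDimensional_coker`), so `z` lies in both
spectra.

The claim for `V_c` follows from `V_c - w = i⁻¹(∂_c - (c + iw))`, since `Re(c + iw) = c - Im w`. -/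

open MeasureTheory

noncomputable section

namespace InfinitesimalShift

/-! ### Bounded inverses and Fredholm operators -/

section Abstract

variable {H : Type*} [NormedAddCommGroup H] [NormedSpace ℂ H]

/-- The operator `S` is a bijection of its domain onto `H` with bounded inverse. -/
def HasBoundedInverse (S : H →ₗ.[ℂ] H) : Prop :=
  ∃ R : H →L[ℂ] H, (∀ y : H, ∃ hy : R y ∈ S.domain, S ⟨R y, hy⟩ = y) ∧
    ∀ x : S.domain, R (S x) = x

theorem mem_resolventSet_iff {T : H →ₗ.[ℂ] H} {z : ℂ} :
    z ∈ resolventSet T ↔ HasBoundedInverse (subScalar T z) :=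
  Iff.rfl

/-- Uniqueness makes the chosen solution map linear, and the estimate makes it bounded. -/
theorem hasBoundedInverse_of_exists_bound {S : H →ₗ.[ℂ] H} (C : ℝ)
    (hinj : ∀ x : S.domain, S x = 0 → x = 0)
    (hsurj : ∀ y : H, ∃ x : S.domain, S x = y ∧ ‖(x : H)‖ ≤ C * ‖y‖) :
    HasBoundedInverse S := by
  have hinj' : ∀ x₁ x₂ : S.domain, S x₁ = S x₂ → x₁ = x₂ := fun x₁ x₂ h =>
    sub_eq_zero.1 (hinj _ (by rw [LinearPMap.map_sub, h, sub_self]))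
  choose r hr hrC using hsurj
  let R : H →ₗ[ℂ] H :=
    { toFun := fun y => r y
      map_add' := fun y₁ y₂ => by
        rw [← Submodule.coe_add]
        exact congrArg _ (hinj' _ _ (by rw [LinearPMap.map_add, hr, hr, hr]))
      map_smul' := fun a y => by
        rw [RingHom.id_apply, ← Submodule.coe_smul]
        exact congrArg _ (hinj' _ _ (by rw [LinearPMap.map_smul, hr, hr])) }
  refine ⟨R.mkContinuous C hrC, fun y => ⟨(r y).2, hr y⟩, fun x => ?_⟩
  exact congrArg Subtype.val (hinj' _ _ (hr (S x)))

theorem HasBoundedInverse.smul {S : H →ₗ.[ℂ] H} (h : HasBoundedInverse S) {a : ℂ} (ha : a ≠ 0) :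
    HasBoundedInverse (a • S) := by
  obtain ⟨R, h₁, h₂⟩ := h
  refine ⟨a⁻¹ • R, fun y => ?_, fun x => ?_⟩
  · obtain ⟨hy, e⟩ := h₁ y
    refine ⟨S.domain.smul_mem _ hy, ?_⟩
    have : S ⟨a⁻¹ • R y, S.domain.smul_mem _ hy⟩ = a⁻¹ • S ⟨R y, hy⟩ :=
      S.map_smul a⁻¹ ⟨R y, hy⟩
    change a • S ⟨a⁻¹ • R y, S.domain.smul_mem _ hy⟩ = y
    rw [this, e, smul_inv_smul₀ ha]
  · change a⁻¹ • R (a • S x) = x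
    rw [map_smul, h₂, inv_smul_smul₀ ha]

theorem range_smul (S : H →ₗ.[ℂ] H) {a : ℂ} (ha : a ≠ 0) :
    LinearMap.range (a • S).toFun = LinearMap.range S.toFun :=
  LinearMap.range_smul S.toFun a ha

theorem HasBoundedInverse.isFredholm {S : H →ₗ.[ℂ] H} (h : HasBoundedInverse S) :
    IsFredholm S := by
  obtain ⟨R, h₁, h₂⟩ := h
  have hker : LinearMap.ker S.toFun = ⊥ := by
    refine LinearMap.ker_eq_bot'.2 fun x hx => Subtype.ext ?_
    have hx' : S x = 0 := hx
    rw [← h₂ x, hx', map_zero, Submodule.coe_zero]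
  have hrange : LinearMap.range S.toFun = ⊤ :=
    LinearMap.range_eq_top.2 fun y => ⟨_, (h₁ y).choose_spec⟩
  refine ⟨?_, ?_, ?_⟩
  · rw [hker]; infer_instance
  · rw [hrange]; exact isClosed_univ
  · rw [hrange]; infer_instance

theorem subScalar_smul_subScalar (T : H →ₗ.[ℂ] H) (a b w : ℂ) (ha : a ≠ 0) :
    subScalar (a⁻¹ • subScalar T b) w = a⁻¹ • subScalar T (b + a * w) := by
  refine LinearPMap.ext rfl fun x hx _ => ?_
  change a⁻¹ • (T ⟨x, hx⟩ - b • x) - w • x = a⁻¹ • (T ⟨x, hx⟩ - (b + a * w) • x)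
  rw [add_smul, ← sub_sub, smul_sub a⁻¹ (_ - _), mul_smul, inv_smul_smul₀ ha]

end Abstract

/-! ### Absolutely continuous solutions of `G' = w G + F` -/

section Primitive

theorem LocallyAC.of_contDiff {g : ℝ → ℂ} (hg : ContDiff ℝ 1 g) : LocallyAC g :=
  fun _ _ => hg.contDiffOn.absolutelyContinuousOnInterval

theorem LocallyAC.mul {g₁ g₂ : ℝ → ℂ} (h₁ : LocallyAC g₁) (h₂ : LocallyAC g₂) :
    LocallyAC fun t => g₁ t * g₂ t :=
  fun a b => (h₁ a b).smul (h₂ a b)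

theorem contDiff_cexp_mul (w : ℂ) : ContDiff ℝ 1 fun t : ℝ => Complex.exp (w * t) :=
  (contDiff_const.mul Complex.ofRealCLM.contDiff).cexp

theorem hasDerivAt_cexp_mul (w : ℂ) (t : ℝ) :
    HasDerivAt (fun t : ℝ => Complex.exp (w * t)) (w * Complex.exp (w * t)) t := by
  have h := ((hasDerivAt_id (t : ℂ)).const_mul w).cexp.comp_ofReal
  simpa [mul_comm] using h

theorem locallyAC_cexp_mul (w : ℂ) : LocallyAC fun t : ℝ => Complex.exp (w * t) :=
  .of_contDiff (contDiff_cexp_mul w)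

/-- Locally absolutely continuous functions with derivative zero almost everywhere are constant. -/
theorem LocallyAC.eq_of_ae_hasDerivAt_zero {g : ℝ → ℂ} (hg : LocallyAC g)
    (h : ∀ᵐ t, HasDerivAt g 0 t) (t : ℝ) : g t = g 0 := by
  obtain ⟨C, hC⟩ := (hg 0 t).const_of_ae_hasDerivAt_zero (h.mono fun _ hx _ => hx)
  rw [hC t Set.right_mem_uIcc, hC 0 Set.left_mem_uIcc]

/-- The solution `e^{wt} (K + ∫₀ᵗ e^{-ws} F(s) ds)` of `G' = w G + F`. -/
def expPrimitive (w K : ℂ) (F : ℝ → ℂ) (t : ℝ) : ℂ :=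
  Complex.exp (w * t) * (K + ∫ s in (0 : ℝ)..t, Complex.exp (-w * s) * F s)

theorem locallyIntegrable_cexp_mul (w : ℂ) {F : ℝ → ℂ} (hF : LocallyIntegrable F) :
    LocallyIntegrable fun s : ℝ => Complex.exp (w * s) * F s :=
  locallyIntegrable_iff.2 fun _ hk => (hF.integrableOn_isCompact hk).continuousOn_mul
    (contDiff_cexp_mul w).continuous.continuousOn hk

theorem locallyAC_integral {h : ℝ → ℂ} (hh : LocallyIntegrable h) :
    LocallyAC fun t => ∫ s in (0 : ℝ)..t, h s := by
  have hi (a b : ℝ) : IntervalIntegrable h volume a b :=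
    intervalIntegrable_iff.2 ((hh.integrableOn_isCompact isCompact_uIcc).mono_set
      Set.uIoc_subset_uIcc)
  -- Reduction to real integrands: the real part is taken with `e = 1`, the imaginary part with `e =
  -- I`.
  have key (L : ℂ →L[ℝ] ℝ) (e : ℂ) :
      LocallyAC fun t => L (∫ s in (0 : ℝ)..t, h s) • e := by
    intro a b
    have hL (x y : ℝ) : IntervalIntegrable (fun s => L (h s)) volume x y :=
      ⟨L.integrable_comp (hi x y).1, L.integrable_comp (hi x y).2⟩
    have hac : AbsolutelyContinuousOnInterval (fun t => ∫ s in (0 : ℝ)..t, L (h s)) a b := by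
      -- The interval is enlarged to contain the base point `0`, then restricted back.
      refine ((hL (min 0 (min a b))
        (max 0 (max a b))).absolutelyContinuousOnInterval_intervalIntegral (c := 0) ?_).mono ?_
      · rw [Set.uIcc_of_le (by simp)]
        simp
      · rw [Set.uIcc_of_le (a := min 0 _) (by simp)]
        intro x hx
        exact ⟨(min_le_right _ _).trans hx.1, hx.2.trans (le_max_right _ _)⟩
    have h := hac.smul (LocallyAC.of_contDiff (contDiff_const (c := e)) a b)
    convert! h using 1
    funext t
    simp only [Pi.smul_apply', L.intervalIntegral_comp_comm (hi 0 t)]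
  intro a b
  convert! (key Complex.reCLM 1 a b).add (key Complex.imCLM Complex.I a b) using 1
  funext t
  simp [Complex.re_add_im]

theorem locallyAC_expPrimitive (w K : ℂ) {F : ℝ → ℂ} (hF : LocallyIntegrable F) :
    LocallyAC (expPrimitive w K F) := by
  refine (locallyAC_cexp_mul w).mul fun a b => ?_
  exact (LocallyAC.of_contDiff (contDiff_const (c := K)) a b).add
    (locallyAC_integral (locallyIntegrable_cexp_mul (-w) hF) a b)

theorem ae_hasDerivAt_expPrimitive (w K : ℂ) {F : ℝ → ℂ} (hF : LocallyIntegrable F) :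
    ∀ᵐ t, HasDerivAt (expPrimitive w K F) (w * expPrimitive w K F t + F t) t := by
  filter_upwards [LocallyIntegrable.ae_hasDerivAt_integral
    (locallyIntegrable_cexp_mul (-w) hF)] with t ht
  have h := (hasDerivAt_cexp_mul w t).mul ((ht 0).const_add K)
  convert! h using 1
  have : Complex.exp (w * t) * Complex.exp (-w * t) = 1 := by
    rw [← Complex.exp_add]; simp
  rw [expPrimitive]
  linear_combination (-F t) * this

end Primitive

/-! ### The Schur test -/

section Schur

open ENNReal

/-- Cauchy–Schwarz against the constant function `1`. -/
theorem lintegral_sq_le {α : Type*} [MeasurableSpace α] (ν : Measure α) {φ : α → ℝ≥0∞}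
    (hφ : AEMeasurable φ ν) : (∫⁻ x, φ x ∂ν) ^ 2 ≤ ν Set.univ * ∫⁻ x, φ x ^ 2 ∂ν := by
  have h := ENNReal.lintegral_mul_le_Lp_mul_Lq ν Real.HolderConjugate.two_two hφ
    (aemeasurable_const (b := (1 : ℝ≥0∞)))
  simp only [Pi.mul_apply, mul_one, lintegral_const,
    ENNReal.rpow_two] at h
  calc (∫⁻ x, φ x ∂ν) ^ 2 ≤ _ := pow_le_pow_left' h 2
    _ = _ := by
      rw [mul_pow, ← ENNReal.rpow_natCast, ← ENNReal.rpow_natCast, ← ENNReal.rpow_mul,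
        ← ENNReal.rpow_mul]
      norm_num [mul_comm]

/-- The Schur test for a convolution kernel. -/
theorem lintegral_sq_lintegral_mul_le {k φ : ℝ → ℝ≥0∞} (hk : Measurable k) (hφ : AEMeasurable φ) :
    ∫⁻ t, (∫⁻ s, k (s - t) * φ s) ^ 2 ≤ (∫⁻ s, k s) ^ 2 * ∫⁻ s, φ s ^ 2 := by
  have h (t : ℝ) : (∫⁻ s, k (s - t) * φ s) ^ 2 ≤ (∫⁻ s, k s) * ∫⁻ s, k (s - t) * φ s ^ 2 := by
    have hkt : Measurable fun s => k (s - t) := by fun_prop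
    -- The kernel serves as the measure; its total mass `∫ k` does not depend on `t`.
    have h := lintegral_sq_le (volume.withDensity fun s => k (s - t))
      (hφ.mono_ac (withDensity_absolutelyContinuous _ _))
    rwa [lintegral_withDensity_eq_lintegral_mul₀ hkt.aemeasurable hφ,
      lintegral_withDensity_eq_lintegral_mul₀ hkt.aemeasurable (hφ.pow_const 2),
      withDensity_apply _ .univ, Measure.restrict_univ, lintegral_sub_right_eq_self] at h
  calc ∫⁻ t, (∫⁻ s, k (s - t) * φ s) ^ 2
      ≤ ∫⁻ t, (∫⁻ s, k s) * ∫⁻ s, k (s - t) * φ s ^ 2 := lintegral_mono h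
    _ = (∫⁻ s, k s) * ∫⁻ t, ∫⁻ s, k (s - t) * φ s ^ 2 := by
        refine lintegral_const_mul'' _ ?_
        refine AEMeasurable.lintegral_prod_right'
          (f := fun p : ℝ × ℝ => k (p.2 - p.1) * φ p.2 ^ 2) ?_
        exact (hk.comp (measurable_snd.sub measurable_fst)).aemeasurable.mul
          ((hφ.comp_snd).pow_const 2)
    _ = (∫⁻ s, k s) * ∫⁻ s, ∫⁻ t, k (s - t) * φ s ^ 2 := by
        rw [lintegral_lintegral_swap]
        exact (hk.comp (measurable_snd.sub measurable_fst)).aemeasurable.mul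
          ((hφ.comp_snd).pow_const 2)
    _ = (∫⁻ s, k s) * ∫⁻ s, (∫⁻ r, k r) * φ s ^ 2 := by
        congr 2 with s
        rw [lintegral_mul_const _ (by fun_prop), lintegral_sub_left_eq_self]
    _ = _ := by rw [lintegral_const_mul'' _ (hφ.pow_const 2), sq, mul_assoc]

end Schur

/-! ### The `L²` bound for the decaying solution -/

section Bound

theorem eLpNorm_two_sq {α : Type*} [MeasurableSpace α] (μ : Measure α) (f : α → ℂ) :
    eLpNorm f 2 μ ^ 2 = ∫⁻ x, ‖f x‖ₑ ^ 2 ∂μ := by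
  have h := eLpNorm_nnreal_pow_eq_lintegral (f := f) (μ := μ) (p := 2) (by norm_num)
  simpa using h

theorem norm_cexp_mul_ofReal (w : ℂ) (t : ℝ) :
    ‖Complex.exp (w * t)‖ = Real.exp (w.re * t) := by
  rw [Complex.norm_exp, Complex.re_mul_ofReal]

theorem integrableOn_cexp_neg_mul {w : ℂ} (hw : 0 < w.re) {F : ℝ → ℂ} (hF : MemLp F 2 volume)
    (t : ℝ) : IntegrableOn (fun s : ℝ => Complex.exp (-w * s) * F s) (Set.Ioi t) := by
  have h : MemLp (fun s : ℝ => Complex.exp (-w * s)) 2 (volume.restrict (Set.Ioi t)) := by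
    rw [memLp_two_iff_integrable_sq_norm
      (contDiff_cexp_mul (-w)).continuous.aestronglyMeasurable]
    refine (integrableOn_exp_mul_Ioi (a := -(2 * w.re)) (by linarith) t).congr
      (Filter.Eventually.of_forall fun s => ?_)
    simp only [norm_cexp_mul_ofReal, ← Real.exp_nat_mul, Complex.neg_re]
    congr 1
    push_cast
    ring
  exact h.integrable_mul (hF.restrict _)

/-- The decaying exponential kernel on the half-line. -/
def decayKernel (a : ℝ) : ℝ → ENNReal :=
  (Set.Ioi 0).indicator fun r => ENNReal.ofReal (Real.exp (-a * r))

theorem measurable_decayKernel (a : ℝ) : Measurable (decayKernel a) :=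
  Measurable.indicator (by fun_prop) measurableSet_Ioi

theorem lintegral_decayKernel {a : ℝ} (ha : 0 < a) :
    ∫⁻ r, decayKernel a r = ENNReal.ofReal (1 / a) := by
  have h := integrableOn_exp_mul_Ioi (a := -a) (by linarith) 0
  rw [decayKernel, lintegral_indicator measurableSet_Ioi,
    ← ofReal_integral_eq_lintegral_ofReal h (.of_forall fun _ => (Real.exp_pos _).le),
    integral_exp_mul_Ioi (by linarith)]
  congr 1
  simp

/-- This `K` moves the base point of the integral from `0` to `+∞`, which removes the growing
exponential. -/
theorem expPrimitive_eq_integral_Ioi {w : ℂ} (hw : 0 < w.re) {F : ℝ → ℂ} (hF : MemLp F 2 volume)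
    (t : ℝ) :
    expPrimitive w (-∫ s in Set.Ioi (0 : ℝ), Complex.exp (-w * s) * F s) F t =
      -∫ s in Set.Ioi t, Complex.exp (w * t) * (Complex.exp (-w * s) * F s) := by
  rw [expPrimitive, integral_const_mul, ← intervalIntegral.integral_Ioi_sub_Ioi'
    (integrableOn_cexp_neg_mul hw hF 0) (integrableOn_cexp_neg_mul hw hF t)]
  ring

theorem enorm_expPrimitive_le {w : ℂ} (hw : 0 < w.re) {F : ℝ → ℂ} (hF : MemLp F 2 volume)
    (t : ℝ) :
    ‖expPrimitive w (-∫ s in Set.Ioi (0 : ℝ), Complex.exp (-w * s) * F s) F t‖ₑ ≤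
      ∫⁻ s, decayKernel w.re (s - t) * ‖F s‖ₑ := by
  rw [expPrimitive_eq_integral_Ioi hw hF, enorm_neg]
  refine (enorm_integral_le_lintegral_enorm _).trans ?_
  rw [← lintegral_indicator measurableSet_Ioi]
  refine lintegral_mono fun s => ?_
  by_cases hs : t < s
  · rw [Set.indicator_of_mem (Set.mem_Ioi.2 hs), decayKernel,
      Set.indicator_of_mem (Set.mem_Ioi.2 (sub_pos.2 hs)), ← mul_assoc, enorm_mul,
      ← ofReal_norm, norm_mul, norm_cexp_mul_ofReal, norm_cexp_mul_ofReal, ← Real.exp_add]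
    refine le_of_eq ?_
    congr 3
    simp
    ring
  · rw [Set.indicator_of_notMem (by simpa using hs)]
    exact zero_le

theorem exists_eLpNorm_expPrimitive_le_of_pos {w : ℂ} (hw : 0 < w.re) {F : ℝ → ℂ}
    (hF : MemLp F 2 volume) :
    ∃ K, eLpNorm (expPrimitive w K F) 2 volume ≤
      ENNReal.ofReal (1 / w.re) * eLpNorm F 2 volume := by
  refine ⟨-∫ s in Set.Ioi (0 : ℝ), Complex.exp (-w * s) * F s, ?_⟩
  rw [← ENNReal.pow_le_pow_left_iff two_ne_zero, mul_pow, eLpNorm_two_sq, eLpNorm_two_sq,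
    ← lintegral_decayKernel hw]
  refine le_trans (lintegral_mono fun t => ?_) (lintegral_sq_lintegral_mul_le
    (measurable_decayKernel w.re) hF.aestronglyMeasurable.enorm)
  exact pow_le_pow_left' (enorm_expPrimitive_le hw hF t) 2

/-- Time reversal flips the sign of `w` and so reduces `Re w < 0` to `Re w > 0`. -/
theorem expPrimitive_neg (w K : ℂ) (F : ℝ → ℂ) (t : ℝ) :
    expPrimitive (-w) K (fun s => F (-s)) (-t) = -expPrimitive w (-K) F t := by
  have h : ∫ s in (0 : ℝ)..-t, Complex.exp (-(-w) * s) * F (-s) =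
      -∫ s in (0 : ℝ)..t, Complex.exp (-w * s) * F s := by
    have h := intervalIntegral.integral_comp_neg (a := 0) (b := -t)
      (fun s : ℝ => Complex.exp (-w * s) * F s)
    rw [neg_neg, neg_zero, intervalIntegral.integral_symm 0 t] at h
    simpa using h
  rw [expPrimitive, expPrimitive, h, Complex.ofReal_neg, neg_mul_neg]
  ring

theorem exists_eLpNorm_expPrimitive_le {w : ℂ} (hw : w.re ≠ 0) {F : ℝ → ℂ}
    (hF : MemLp F 2 volume) :
    ∃ K, eLpNorm (expPrimitive w K F) 2 volume ≤
      ENNReal.ofReal (1 / |w.re|) * eLpNorm F 2 volume := by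
  rcases hw.lt_or_gt with hw | hw
  · have hmp := Measure.measurePreserving_neg (volume : Measure ℝ)
    obtain ⟨K, hK⟩ := exists_eLpNorm_expPrimitive_le_of_pos (w := -w) (by simpa using hw)
      (hF.comp_measurePreserving hmp)
    refine ⟨-K, ?_⟩
    have hF' : LocallyIntegrable (F ∘ Neg.neg) volume :=
      (hF.comp_measurePreserving hmp).locallyIntegrable one_le_two
    rw [eLpNorm_comp_measurePreserving hF.aestronglyMeasurable hmp,
      ← eLpNorm_comp_measurePreserving
        (locallyAC_expPrimitive _ _ hF').continuous.aestronglyMeasurable hmp] at hK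
    rw [abs_of_neg hw, ← Complex.neg_re, ← eLpNorm_neg]
    convert hK using 2
    funext t
    exact (expPrimitive_neg w K F t).symm
  · rw [abs_of_pos hw]
    exact exists_eLpNorm_expPrimitive_le_of_pos hw hF

end Bound

/-! ### Passing between weighted and unweighted `L²` -/

section Weight

theorem weightedMeasure_ac (c : ℝ) : weightedMeasure c ≪ volume :=
  withDensity_absolutelyContinuous _ _

theorem ac_weightedMeasure (c : ℝ) : volume ≪ weightedMeasure c :=
  Measure.ae_le_iff_absolutelyContinuous.1 fun _ h => (ae_weightedMeasure_iff c).1 h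

/-- The weight is `|e^{-zt}|²`. Any `z` on the line is allowed: `z = c` serves the resolvent, the
spectral point itself serves the cokernel. -/
theorem eLpNorm_weightedMeasure {c : ℝ} {z : ℂ} (hz : z.re = c) (f : ℝ → ℂ) :
    eLpNorm f 2 (weightedMeasure c) =
      eLpNorm (fun t : ℝ => Complex.exp (-z * t) * f t) 2 volume := by
  refine (ENNReal.pow_right_strictMono two_ne_zero).injective ?_
  rw [eLpNorm_two_sq, eLpNorm_two_sq, weightedMeasure,
    lintegral_withDensity_eq_lintegral_mul_non_measurable _ (by fun_prop) (by simp)]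
  refine lintegral_congr fun t => ?_
  rw [Pi.mul_apply, enorm_mul, mul_pow, ← ofReal_norm (Complex.exp _),
    norm_cexp_mul_ofReal, ← ENNReal.ofReal_pow (Real.exp_pos _).le, ← Real.exp_nat_mul]
  congr 3
  simp [hz]
  ring

theorem memLp_weightedMeasure_iff {c : ℝ} {z : ℂ} (hz : z.re = c) (f : ℝ → ℂ) :
    MemLp f 2 (weightedMeasure c) ↔
      MemLp (fun t : ℝ => Complex.exp (-z * t) * f t) 2 volume := by
  have hcont := (contDiff_cexp_mul (-z)).continuous.aestronglyMeasurable (μ := volume)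
  have hcont' := (contDiff_cexp_mul z).continuous.aestronglyMeasurable (μ := volume)
  rw [MemLp, MemLp, eLpNorm_weightedMeasure hz]
  refine and_congr_left fun _ => ⟨fun h => hcont.mul (h.mono_ac (ac_weightedMeasure c)),
    fun h => ((hcont'.mul h).congr (.of_forall fun t => ?_)).mono_ac (weightedMeasure_ac c)⟩
  simp [← mul_assoc, ← Complex.exp_add]

end Weight

/-! ### The resolvent off the line `Re z = c` -/

section Resolvent

theorem infShift_coeFn {c : ℝ} (u : shiftDomain c) :
    (infShift c u : ℝ → ℂ) =ᵐ[weightedMeasure c] deriv (rep u) :=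
  (isRegularRep_rep u).memLp_deriv.coeFn_toLp

theorem subScalar_infShift_apply {c : ℝ} (z : ℂ) (u : shiftDomain c) :
    subScalar (infShift c) z u = infShift c u - z • (u : WeightedL2 c) :=
  rfl

theorem ae_hasDerivAt_rep {c : ℝ} (z : ℂ) (u : shiftDomain c) :
    ∀ᵐ t, HasDerivAt (rep u) (z * rep u t + (subScalar (infShift c) z u : WeightedL2 c) t) t := by
  have h : ∀ᵐ t, (subScalar (infShift c) z u : WeightedL2 c) t =
      deriv (rep u) t - z * rep u t := by
    refine (ae_weightedMeasure_iff c).1 ?_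
    rw [subScalar_infShift_apply]
    filter_upwards [Lp.coeFn_sub (infShift c u) (z • (u : WeightedL2 c)),
      Lp.coeFn_smul z (u : WeightedL2 c), infShift_coeFn u,
      (isRegularRep_rep u).ae_eq] with t h₁ h₂ h₃ h₄
    rw [h₁, Pi.sub_apply, h₂, h₃, Pi.smul_apply, h₄, smul_eq_mul]
  filter_upwards [h, (isRegularRep_rep u).locallyAC.ae_differentiableAt] with t h₁ h₂
  rw [h₁, add_sub_cancel]
  exact h₂.hasDerivAt

theorem exists_subScalar_infShift_eq {c : ℝ} {z : ℂ} {g : ℝ → ℂ} {f : WeightedL2 c}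
    (hac : LocallyAC g) (hg : MemLp g 2 (weightedMeasure c))
    (hderiv : ∀ᵐ t, HasDerivAt g (z * g t + f t) t) :
    ∃ u : shiftDomain c, (u : WeightedL2 c) = hg.toLp g ∧ subScalar (infShift c) z u = f := by
  have hd : deriv g =ᵐ[weightedMeasure c] z • g + f :=
    (ae_weightedMeasure_iff c).2 (hderiv.mono fun t ht => ht.deriv)
  have hreg : IsRegularRep c (hg.toLp g) g :=
    ⟨hg.coeFn_toLp, hac, ((hg.const_smul z).add (Lp.memLp f)).ae_eq hd.symm⟩
  refine ⟨⟨_, g, hreg⟩, rfl, ?_⟩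
  rw [subScalar_infShift_apply, sub_eq_iff_eq_add]
  refine Lp.ext ?_
  have hrep : rep ⟨hg.toLp g, g, hreg⟩ = g := (isRegularRep_rep ⟨_, g, hreg⟩).unique hreg
  filter_upwards [infShift_coeFn ⟨hg.toLp g, g, hreg⟩, hd,
    Lp.coeFn_add f (z • hg.toLp g), Lp.coeFn_smul z (hg.toLp g), hg.coeFn_toLp]
    with t h₁ h₂ h₃ h₄ h₅
  rw [h₁, hrep, h₂, h₃, Pi.add_apply, Pi.add_apply, h₄, Pi.smul_apply, Pi.smul_apply, h₅, add_comm]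

theorem LocallyAC.cexp_mul {g : ℝ → ℂ} (hg : LocallyAC g) (z : ℂ) :
    LocallyAC fun t : ℝ => Complex.exp (z * t) * g t :=
  (locallyAC_cexp_mul z).mul hg

theorem HasDerivAt.cexp_mul {g : ℝ → ℂ} {z w b : ℂ} {t : ℝ} (hg : HasDerivAt g (z * g t + b) t) :
    HasDerivAt (fun t : ℝ => Complex.exp (w * t) * g t)
      ((w + z) * (Complex.exp (w * t) * g t) + Complex.exp (w * t) * b) t := by
  convert! (hasDerivAt_cexp_mul w t).mul hg using 1
  ring

/-- Chebyshev: the superlevel sets of an `L²` function have finite measure. -/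
theorem not_memLp_of_le_norm {g : ℝ → ℂ} {s : Set ℝ} (hs : volume s = ⊤) {ε : ℝ} (hε : 0 < ε)
    (h : ∀ t ∈ s, ε ≤ ‖g t‖) : ¬ MemLp g 2 volume := by
  intro hg
  have hlt := hg.meas_ge_lt_top two_ne_zero ENNReal.ofNat_ne_top (ε := ⟨ε, hε.le⟩)
    (fun h => hε.ne' (congrArg NNReal.toReal h))
  exact (hs ▸ (measure_mono fun t ht => h t ht).trans_lt hlt).ne rfl

theorem memLp_rep {c : ℝ} {z : ℂ} (hz : z.re = c) (u : shiftDomain c) :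
    MemLp (fun t : ℝ => Complex.exp (-z * t) * rep u t) 2 volume :=
  (memLp_weightedMeasure_iff hz _).1
    ((Lp.memLp (u : WeightedL2 c)).ae_eq (isRegularRep_rep u).ae_eq)

theorem eq_zero_of_subScalar_infShift_eq_zero {c : ℝ} {z : ℂ} (hz : z.re ≠ c) (u : shiftDomain c)
    (hu : subScalar (infShift c) z u = 0) : u = 0 := by
  have hderiv := ae_hasDerivAt_rep z u
  rw [hu] at hderiv
  have hconst := (LocallyAC.cexp_mul (isRegularRep_rep u).locallyAC (-z)).eq_of_ae_hasDerivAt_zero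
    (by
      filter_upwards [hderiv, (ae_weightedMeasure_iff c).1 (Lp.coeFn_zero ℂ 2 (weightedMeasure c))]
        with t h₁ h₂
      rw [h₂] at h₁
      simpa using HasDerivAt.cexp_mul (w := -z) h₁)
  have hrep (t : ℝ) : rep u t = rep u 0 * Complex.exp (z * t) := by
    have h := hconst t
    simp only [Complex.ofReal_zero, mul_zero, Complex.exp_zero, one_mul] at h
    rw [← h, mul_right_comm, ← Complex.exp_add]
    simp
  have hmem := memLp_rep (Complex.ofReal_re c) u
  have h0 : rep u 0 = 0 := by
    by_contra hne
    have hnorm (t : ℝ) : ‖Complex.exp (-(c : ℂ) * t) * rep u t‖ =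
        ‖rep u 0‖ * Real.exp ((z.re - c) * t) := by
      rw [hrep t, norm_mul, norm_mul, norm_cexp_mul_ofReal, norm_cexp_mul_ofReal, mul_left_comm,
        ← Real.exp_add]
      congr 2
      simp
      ring
    have hle (t : ℝ) (ht : 0 ≤ (z.re - c) * t) :
        ‖rep u 0‖ ≤ ‖Complex.exp (-(c : ℂ) * t) * rep u t‖ := by
      rw [hnorm]
      exact le_mul_of_one_le_right (norm_nonneg _) (Real.one_le_exp ht)
    -- The sign of `Re z - c` decides on which half-line the exponential is at least `1`.
    rcases hz.lt_or_gt with h | h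
    · exact not_memLp_of_le_norm (s := Set.Iic 0) Real.volume_Iic (norm_pos_iff.2 hne)
        (fun t ht => hle t (mul_nonneg_of_nonpos_of_nonpos (by linarith) ht)) hmem
    · exact not_memLp_of_le_norm (s := Set.Ici 0) Real.volume_Ici (norm_pos_iff.2 hne)
        (fun t ht => hle t (mul_nonneg (by linarith) ht)) hmem
  refine Subtype.ext (Lp.ext ?_)
  filter_upwards [(isRegularRep_rep u).ae_eq, Lp.coeFn_zero ℂ 2 (weightedMeasure c)] with t h₁ h₂
  rw [h₁, hrep, h0, zero_mul]
  exact h₂.symm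

/-- The substitution `u = e^{ct} G` leads to `G' = (z - c) G + e^{-ct} f` in `L²(ℝ)`. -/
theorem exists_solution {c : ℝ} {z : ℂ} (hz : z.re ≠ c) (f : WeightedL2 c) :
    ∃ u : shiftDomain c, subScalar (infShift c) z u = f ∧
      ‖(u : WeightedL2 c)‖ ≤ 1 / |z.re - c| * ‖f‖ := by
  have hF := (memLp_weightedMeasure_iff (Complex.ofReal_re c) f).1 (Lp.memLp f)
  have hw : (z - c).re ≠ 0 := by simpa [sub_eq_zero] using hz
  obtain ⟨K, hK⟩ := exists_eLpNorm_expPrimitive_le hw hF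
  have hloc := hF.locallyIntegrable one_le_two
  set G := expPrimitive (z - c) K fun t : ℝ => Complex.exp (-c * t) * f t with hG
  have hexp (t : ℝ) : Complex.exp (c * t) * Complex.exp (-c * t) = 1 := by
    rw [← Complex.exp_add]
    simp
  have hGac : LocallyAC G := locallyAC_expPrimitive _ _ hloc
  have hcancel : (fun t : ℝ => Complex.exp (-c * t) * (Complex.exp (c * t) * G t)) = G := by
    funext t
    linear_combination G t * hexp t
  have hGmem : MemLp G 2 volume :=
    ⟨hGac.continuous.aestronglyMeasurable,
      hK.trans_lt (ENNReal.mul_lt_top ENNReal.ofReal_lt_top hF.2)⟩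
  have hg : MemLp (fun t : ℝ => Complex.exp (c * t) * G t) 2 (weightedMeasure c) := by
    rw [memLp_weightedMeasure_iff (Complex.ofReal_re c), hcancel]
    exact hGmem
  obtain ⟨u, hu, hu'⟩ := exists_subScalar_infShift_eq (z := z) (f := f) (hGac.cexp_mul c) hg (by
    filter_upwards [ae_hasDerivAt_expPrimitive (z - c) K hloc] with t ht
    convert! HasDerivAt.cexp_mul (w := c) ht using 1
    linear_combination (-f t) * hexp t)
  refine ⟨u, hu', ?_⟩
  rw [hu, Lp.norm_toLp, Lp.norm_def, eLpNorm_weightedMeasure (Complex.ofReal_re c),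
    eLpNorm_weightedMeasure (Complex.ofReal_re c) f, hcancel]
  have h := ENNReal.toReal_mono (ENNReal.mul_ne_top ENNReal.ofReal_ne_top hF.2.ne) hK
  rwa [ENNReal.toReal_mul, ENNReal.toReal_ofReal (by positivity)] at h

theorem hasBoundedInverse_subScalar_infShift {c : ℝ} {z : ℂ} (hz : z.re ≠ c) :
    HasBoundedInverse (subScalar (infShift c) z) :=
  hasBoundedInverse_of_exists_bound _ (eq_zero_of_subScalar_infShift_eq_zero hz)
    (exists_solution hz)

end Resolvent

/-! ### Infinite-dimensional cokernel on the line `Re z = c` -/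

section Cokernel

open Polynomial

/-- The logarithm `log (1 + t²)`. -/
def logSq (t : ℝ) : ℝ := Real.log (1 + t ^ 2)

theorem logSq_nonneg (t : ℝ) : 0 ≤ logSq t := Real.log_nonneg (by nlinarith [sq_nonneg t])

theorem tendsto_logSq : Filter.Tendsto logSq Filter.atTop Filter.atTop :=
  Real.tendsto_log_atTop.comp
    (Filter.tendsto_atTop_add_const_left _ _ (Filter.tendsto_pow_atTop two_ne_zero))

theorem contDiff_logSq : ContDiff ℝ 1 logSq :=
  (contDiff_const.add (contDiff_id.pow 2)).log fun t => by
    simp only [id]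
    positivity

theorem hasDerivAt_logSq (t : ℝ) : HasDerivAt logSq (2 * t / (1 + t ^ 2)) t := by
  have h := ((hasDerivAt_pow 2 t).const_add 1).log (by positivity)
  simpa using! h

theorem contDiff_eval_logSq (P : ℂ[X]) : ContDiff ℝ 1 fun t => P.eval (logSq t : ℂ) :=
  (P.contDiff_aeval (𝕜 := ℂ) (n := 1) |>.restrict_scalars ℝ).comp
    (Complex.ofRealCLM.contDiff.comp contDiff_logSq)

theorem hasDerivAt_eval_logSq (P : ℂ[X]) (t : ℝ) :
    HasDerivAt (fun t => P.eval (logSq t : ℂ))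
      (P.derivative.eval (logSq t : ℂ) * (2 * t / (1 + t ^ 2) : ℝ)) t :=
  HasDerivAt.comp (h₂ := fun x => P.eval x) t (P.hasDerivAt (logSq t : ℂ))
    (hasDerivAt_logSq t).ofReal_comp

theorem memLp_rpow_one_add_sq : MemLp (fun t : ℝ => (1 + t ^ 2) ^ (-3 / 8 : ℝ)) 2 volume := by
  have hc : Continuous fun t : ℝ => (1 + t ^ 2) ^ (-3 / 8 : ℝ) :=
    (by fun_prop : Continuous fun t : ℝ => 1 + t ^ 2).rpow_const fun t => .inl (by positivity)
  rw [memLp_two_iff_integrable_sq_norm hc.aestronglyMeasurable]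
  have h := integrable_rpow_neg_one_add_norm_sq (E := ℝ) (μ := volume) (r := 3 / 2)
    (by norm_num)
  refine h.congr (.of_forall fun t => ?_)
  have h1 : (0 : ℝ) ≤ 1 + t ^ 2 := by positivity
  simp only [Real.norm_eq_abs, sq_abs]
  rw [← Real.rpow_mul_natCast h1]
  norm_num

/-- The power of the logarithm costs a factor `(1+t²)^{1/8}`, the fraction decays like
`(1+t²)^{-1/2}`. The resulting exponent `-3/8` is below the `L²` threshold `-1/4`. -/
theorem norm_pow_logSq_mul_le (n : ℕ) (t : ℝ) :
    |logSq t ^ n * (2 * t / (1 + t ^ 2))| ≤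
      8 ^ n * n.factorial * 2 * (1 + t ^ 2) ^ (-3 / 8 : ℝ) := by
  have h0 : (0 : ℝ) < 1 + t ^ 2 := by positivity
  have h1 : logSq t ^ n ≤ 8 ^ n * n.factorial * (1 + t ^ 2) ^ (1 / 8 : ℝ) := by
    -- `xⁿ/n! ≤ eˣ` at `x = log(1+t²)/8` yields the constant `8ⁿ n!`.
    have h := Real.pow_div_factorial_le_exp (logSq t / 8) (by linarith [logSq_nonneg t]) n
    rw [div_le_iff₀ (by positivity), div_pow, div_le_iff₀ (by positivity)] at h
    rw [Real.rpow_def_of_pos h0]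
    refine h.trans (le_of_eq ?_)
    rw [logSq, mul_one_div]
    ring
  have h2 : |2 * t / (1 + t ^ 2)| ≤ 2 * (1 + t ^ 2) ^ (-1 / 2 : ℝ) := by
    have hs : (1 + t ^ 2) ^ (-1 / 2 : ℝ) = Real.sqrt (1 + t ^ 2) / (1 + t ^ 2) := by
      rw [Real.sqrt_eq_rpow, ← Real.rpow_sub_one h0.ne']
      norm_num
    rw [hs, abs_div, abs_mul, abs_of_pos h0, abs_two, ← mul_div_assoc]
    gcongr
    exact Real.abs_le_sqrt (by linarith)
  rw [abs_mul, abs_of_nonneg (pow_nonneg (logSq_nonneg t) n)]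
  calc _ ≤ (8 ^ n * n.factorial * (1 + t ^ 2) ^ (1 / 8 : ℝ)) *
        (2 * (1 + t ^ 2) ^ (-1 / 2 : ℝ)) := by gcongr
    _ = 8 ^ n * n.factorial * 2 * ((1 + t ^ 2) ^ (1 / 8 : ℝ) * (1 + t ^ 2) ^ (-1 / 2 : ℝ)) := by
        ring
    _ = _ := by
        rw [← Real.rpow_add h0]
        norm_num

theorem memLp_eval_logSq_mul (Q : ℂ[X]) :
    MemLp (fun t : ℝ => Q.eval (logSq t : ℂ) * (2 * t / (1 + t ^ 2) : ℝ)) 2 volume := by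
  induction Q using Polynomial.induction_on' with
  | add p q hp hq => simpa only [eval_add, add_mul] using! hp.add hq
  | monomial n a =>
    refine memLp_rpow_one_add_sq.of_le_mul (c := ‖a‖ * (8 ^ n * n.factorial * 2)) ?_
      (.of_forall fun t => ?_)
    · refine Continuous.aestronglyMeasurable
        ((contDiff_eval_logSq (monomial n a)).continuous.mul
          (Complex.continuous_ofReal.comp ?_))
      exact (by fun_prop : Continuous fun t : ℝ => 2 * t).div₀ (by fun_prop) fun t => by positivity
    · have h := norm_pow_logSq_mul_le n t
      rw [eval_monomial, mul_assoc, norm_mul, ← Complex.ofReal_pow, ← Complex.ofReal_mul,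
        Complex.norm_real, Real.norm_eq_abs, mul_assoc,
        Real.norm_of_nonneg (by positivity : (0 : ℝ) ≤ (1 + t ^ 2) ^ (-3 / 8 : ℝ))]
      gcongr

/-- The function `e^{zt} (d/dt) P(log (1 + t²))`. -/
def logTest (z : ℂ) (P : ℂ[X]) (t : ℝ) : ℂ :=
  Complex.exp (z * t) * (P.derivative.eval (logSq t : ℂ) * (2 * t / (1 + t ^ 2) : ℝ))

theorem cexp_neg_mul_logTest (z : ℂ) (P : ℂ[X]) (t : ℝ) :
    Complex.exp (-z * t) * logTest z P t =
      P.derivative.eval (logSq t : ℂ) * (2 * t / (1 + t ^ 2) : ℝ) := by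
  rw [logTest, ← mul_assoc, ← Complex.exp_add]
  simp

theorem memLp_logTest {c : ℝ} {z : ℂ} (hz : z.re = c) (P : ℂ[X]) :
    MemLp (logTest z P) 2 (weightedMeasure c) := by
  rw [memLp_weightedMeasure_iff hz]
  simp only [cexp_neg_mul_logTest]
  exact memLp_eval_logSq_mul _

/-- The linear map sending `P` to the class of `logTest z P`. -/
def logTestLinearMap {c : ℝ} {z : ℂ} (hz : z.re = c) : ℂ[X] →ₗ[ℂ] WeightedL2 c where
  toFun P := (memLp_logTest hz P).toLp _
  map_add' P Q := by
    rw [← MemLp.toLp_add, MemLp.toLp_eq_toLp_iff]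
    refine .of_forall fun t => ?_
    simp only [logTest, Pi.add_apply, derivative_add, eval_add]
    ring
  map_smul' a P := by
    rw [RingHom.id_apply, ← MemLp.toLp_const_smul, MemLp.toLp_eq_toLp_iff]
    refine .of_forall fun t => ?_
    simp only [logTest, Pi.smul_apply, derivative_smul, eval_smul, smul_eq_mul]
    ring

/-- A nonconstant polynomial of `log(1+t²)` tends to infinity in modulus. -/
theorem natDegree_eq_zero_of_memLp {Q : ℂ[X]}
    (hQ : MemLp (fun t => Q.eval (logSq t : ℂ)) 2 volume) : Q.natDegree = 0 := by
  by_contra hne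
  have hL : Filter.Tendsto (fun t => ‖(logSq t : ℂ)‖) Filter.atTop Filter.atTop := by
    simpa only [Complex.norm_real] using! tendsto_norm_atTop_atTop.comp tendsto_logSq
  have h := Q.tendsto_norm_atTop (natDegree_pos_iff_degree_pos.1 (Nat.pos_of_ne_zero hne)) hL
  obtain ⟨N, hN⟩ := Filter.eventually_atTop.1 (h.eventually_ge_atTop 1)
  exact not_memLp_of_le_norm (s := Set.Ici N) Real.volume_Ici one_pos hN hQ

theorem natDegree_eq_zero_of_logTest_mem_range {c : ℝ} {z : ℂ} (hz : z.re = c) {P : ℂ[X]}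
    (h : logTestLinearMap hz P ∈ LinearMap.range (subScalar (infShift c) z).toFun) :
    P.natDegree = 0 := by
  obtain ⟨u, hu⟩ := h
  have hu' : subScalar (infShift c) z u = logTestLinearMap hz P := hu
  have hderiv := ae_hasDerivAt_rep z u
  rw [hu'] at hderiv
  have hf := (ae_weightedMeasure_iff c).1 (memLp_logTest hz P).coeFn_toLp
  have hac : LocallyAC ((fun t : ℝ => Complex.exp (-z * t) * rep u t) -
      fun t => P.eval (logSq t : ℂ)) := fun a b =>
    (((isRegularRep_rep u).locallyAC.cexp_mul (-z)) a b).sub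
      (LocallyAC.of_contDiff (contDiff_eval_logSq P) a b)
  have hconst := hac.eq_of_ae_hasDerivAt_zero (by
    filter_upwards [hderiv, hf] with t h₁ h₂
    have h₃ : (logTestLinearMap hz P : WeightedL2 c) t = logTest z P t := h₂
    rw [h₃] at h₁
    have h₄ := (HasDerivAt.cexp_mul (w := -z) h₁).sub (hasDerivAt_eval_logSq P t)
    rw [cexp_neg_mul_logTest] at h₄
    simpa using h₄)
  -- The constant of integration: `P + K` evaluated at `log(1+t²)` equals `e^{-zt} u`, hence is in
  -- `L²`, and `P + K` has the degree of `P`.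
  set K := ((fun t : ℝ => Complex.exp (-z * t) * rep u t) - fun t => P.eval (logSq t : ℂ)) 0
  rw [← natDegree_add_C (a := K)]
  refine natDegree_eq_zero_of_memLp ?_
  convert memLp_rep hz u using 2 with t
  rw [eval_add, eval_C, ← hconst t, Pi.sub_apply, add_sub_cancel]

theorem not_finiteDimensional_coker {c : ℝ} {z : ℂ} (hz : z.re = c) :
    ¬ FiniteDimensional ℂ
      (WeightedL2 c ⧸ LinearMap.range (subScalar (infShift c) z).toFun) := by
  intro hfin
  set r := LinearMap.range (subScalar (infShift c) z).toFun
  -- Multiplying by `X` gives every nonzero polynomial positive degree, so constants cannot spoil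
  -- injectivity.
  let Ψ : ℂ[X] →ₗ[ℂ] WeightedL2 c ⧸ r :=
    r.mkQ ∘ₗ logTestLinearMap hz ∘ₗ LinearMap.mulLeft ℂ X
  have hinj : Function.Injective Ψ := by
    refine (injective_iff_map_eq_zero Ψ).2 fun P hP => ?_
    by_contra hne
    have h := natDegree_eq_zero_of_logTest_mem_range hz ((Submodule.Quotient.mk_eq_zero r).1 hP)
    rw [LinearMap.mulLeft_apply, natDegree_X_mul hne] at h
    exact Nat.succ_ne_zero _ h
  exact Polynomial.not_finite (FiniteDimensional.of_injective Ψ hinj)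

end Cokernel

/-! ### Transfer to `V_c` and conclusion -/

section Momentum

theorem subScalar_momentum (c : ℝ) (w : ℂ) :
    subScalar (momentum c) w =
      Complex.I⁻¹ • subScalar (infShift c) (c + Complex.I * w) :=
  subScalar_smul_subScalar _ _ _ _ Complex.I_ne_zero

theorem re_add_I_mul (c : ℝ) (w : ℂ) : ((c : ℂ) + Complex.I * w).re = c - w.im := by
  simp [sub_eq_add_neg]

end Momentum

/-- If `T - z` is boundedly invertible off `s` and has infinite-dimensional cokernel on `s`, then
`s` is the spectrum and the essential spectrum of `T`. -/
theorem spectrum_eq_and_essentialSpectrum_eq {H : Type*} [NormedAddCommGroup H] [NormedSpace ℂ H]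
    {T : H →ₗ.[ℂ] H} {s : Set ℂ} (h₁ : ∀ z ∉ s, HasBoundedInverse (subScalar T z))
    (h₂ : ∀ z ∈ s, ¬ FiniteDimensional ℂ (H ⧸ LinearMap.range (subScalar T z).toFun)) :
    spectrum T = s ∧ essentialSpectrum T = s := by
  refine ⟨Set.ext fun z => ⟨fun hz => ?_, fun hz hz' => ?_⟩,
    Set.ext fun z => ⟨fun hz => ?_, fun hz hz' => ?_⟩⟩
  · by_contra hs
    exact hz (mem_resolventSet_iff.2 (h₁ z hs))
  · exact h₂ z hz (mem_resolventSet_iff.1 hz').isFredholm.finite_coker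
  · by_contra hs
    exact hz (h₁ z hs).isFredholm
  · exact h₂ z hz hz'.finite_coker

end InfinitesimalShift

end

theorem mainTheorem9 (c : ℝ) (hc : 0 ≤ c) :
    (InfinitesimalShift.spectrum (InfinitesimalShift.infShift c) = {z : ℂ | z.re = c} ∧
      InfinitesimalShift.essentialSpectrum (InfinitesimalShift.infShift c) =
        {z : ℂ | z.re = c}) ∧
    (InfinitesimalShift.spectrum (InfinitesimalShift.momentum c) =
        Set.range ((↑) : ℝ → ℂ) ∧
      InfinitesimalShift.essentialSpectrum (InfinitesimalShift.momentum c) =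
        Set.range ((↑) : ℝ → ℂ)) := by
  refine ⟨InfinitesimalShift.spectrum_eq_and_essentialSpectrum_eq
    (fun z hz => InfinitesimalShift.hasBoundedInverse_subScalar_infShift hz)
    (fun z hz => InfinitesimalShift.not_finiteDimensional_coker hz),
    InfinitesimalShift.spectrum_eq_and_essentialSpectrum_eq (fun w hw => ?_) ?_⟩
  · rw [InfinitesimalShift.subScalar_momentum]
    refine (InfinitesimalShift.hasBoundedInverse_subScalar_infShift ?_).smul
      (inv_ne_zero Complex.I_ne_zero)
    rw [InfinitesimalShift.re_add_I_mul]
    intro h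
    exact hw ⟨w.re, Complex.ext (by simp) (by simp; linarith)⟩
  · rintro _ ⟨x, rfl⟩
    rw [InfinitesimalShift.subScalar_momentum,
      InfinitesimalShift.range_smul _ (inv_ne_zero Complex.I_ne_zero)]
    exact InfinitesimalShift.not_finiteDimensional_coker
      (by rw [InfinitesimalShift.re_add_I_mul, Complex.ofReal_im, sub_zero])
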